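/- Let $\mathbb{N}^*=\{0,0^*,1,1^*,2,2^*,\dots\}$ be ordered by $0\prec 0^*\prec 1\prec 1^*\prec\cdots$; for $x\in\mathbb{N}$ let $|x|=|x^*|=x$, and for $k \in \mathbb{N}$ let $[k]=\{0,0^*,\dots,k,k^*\}$. The mark $*$ denotes the tie-breaking advantage. For $x,y\in\mathbb{N}$ put $x\oplus y=x+y$, $x^*\oplus y=x\oplus y^*=(x+y)^*$, $x\ominus y=x-y$, $x^*\ominus y=(x-y)^*$, $x^*\ominus y^*=x-y$. An energy bidding game $\mathcal{G}=\langle V,E,k,w\rangle$ consists of a finite directed graph $\langle V,E\rangle$ in which every vertex $v$ has a non-empty set $N(v)=\{u:(v,u)\in E\}$ of neighbours, a total budget $k\in\mathbb{N}$, and a weight function $w:E\to\mathbb{Z}$. A configuration $\langle v,B\rangle\in V\times[k]$ means that the token is at $v$, that player Pres has budget $B$, and that player Cons has budget $k^*\ominus B$. In each turn the players simultaneously choose actions $\langle b_1,v_1\rangle$ (Pres) and $\langle b_2,v_2\rangle$ (Cons), where $v_1,v_2\in N(v)$, each bid is at most the bidder's budget, and a bid may carry $*$ only if the bidder's budget does.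 If $b_1\succ b_2$, or if $b_1=b_2$ and $B\in\mathbb{N}$, the next configuration is $\langle v_1,B\ominus b_1\rangle$; otherwise it is $\langle v_2,B\oplus b_2\rangle$. Strategies are deterministic functions from finite histories of configurations to allowed actions. For an initial energy $M\in\mathbb{Z}$, Pres $M$-wins an infinite path $v_0,v_1,\dots$ if $M+\sum_{j<m}w(v_j,v_{j+1})\ge 0$ for every $m\in\mathbb{N}$, and otherwise Cons $M$-wins it. A player $M$-wins from a configuration if the player has a strategy such that, against every strategy of the opponent, the player $M$-wins the resulting path. An energy threshold is a function $\mathrm{en}:V\times[k]\to\mathbb{N}\cup\{\infty\}$ such that, for every configuration $\langle v,B\rangle$: if $\mathrm{en}(v,B)=M\in\mathbb{N}$, then Pres $M$-wins and Cons $(M-1)$-wins from $\langle v,B\rangle$; if $\mathrm{en}(v,B)=\infty$, then Cons $M$-wins from $\langle v,B\rangle$ for every $M\in\mathbb{N}$. The threshold budget $\mathrm{Th}:V\to[k]\cup\{k+1\}$ assigns to $v$ the least $B\in[k]$ with $\mathrm{en}(v,B)<\infty$, and $k+1$ if there is no such $B$. Theorem. In every energy bidding game there is exactly one energy threshold $\mathrm{en}$,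 so that $\mathrm{Th}$ is well defined, and $\mathrm{Th}$ satisfies the average property: for every $v\in V$, if $v^+$ and $v^-$ are neighbours of $v$ at which $\mathrm{Th}$ is maximal and minimal, respectively, among the neighbours of $v$, then $$\mathrm{Th}(v)=\left\lfloor\frac{|\mathrm{Th}(v^+)|+|\mathrm{Th}(v^-)|}{2}\right\rfloor+\varepsilon,$$ where $\varepsilon=0$ if $|\mathrm{Th}(v^+)|+|\mathrm{Th}(v^-)|$ is even and $\mathrm{Th}(v^-)\in\mathbb{N}$; $\varepsilon=1$ if this sum is odd and $\mathrm{Th}(v^-)\in\mathbb{N}^*\setminus\mathbb{N}$; and $\varepsilon=*$ otherwise (for $m\in\mathbb{N}$, $m+*$ means $m^*$). -/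

import Mathlib

/-- The set `ℕ* = {0, 0*, 1, 1*, …}` of budgets and bids: a natural number together with a flag
saying whether the tie-breaking advantage `*` is held (for a budget) or used (for a bid). -/
structure StarNat where
  /-- The integral part `|B|`. -/
  int : ℕ
  /-- The advantage flag: `⟨x, true⟩` is `x*` and `⟨x, false⟩` is `x`. -/
  adv : Bool

namespace StarNat

/-- The position of an element in the order `0 ≺ 0* ≺ 1 ≺ 1* ≺ …`. -/
def code (B : StarNat) : ℕ := 2 * B.int + B.adv.toNat

theorem code_injective : Function.Injective code := by
  rintro ⟨x, a⟩ ⟨y, b⟩ h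
  cases a <;> cases b <;> simp [code] at h ⊢ <;> omega

/-- The order `0 ≺ 0* ≺ 1 ≺ 1* ≺ …`. -/
noncomputable instance : LinearOrder StarNat := LinearOrder.lift' code code_injective

theorem le_iff_code (A B : StarNat) : A ≤ B ↔ A.code ≤ B.code := Iff.rfl

theorem lt_iff_code (A B : StarNat) : A < B ↔ A.code < B.code := by
  rw [← not_le, ← not_le, le_iff_code]

instance : WellFoundedLT StarNat :=
  ⟨Subrelation.wf (fun {A B} h => (lt_iff_code A B).1 h) (InvImage.wf code wellFounded_lt)⟩

/-- `x ⊕ y = x + y`, `x* ⊕ y = x ⊕ y* = (x + y)*`, `x* ⊕ y* = x + y + 1`. -/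
def oplus : StarNat → StarNat → StarNat
  | ⟨x, false⟩, ⟨y, false⟩ => ⟨x + y, false⟩
  | ⟨x, true⟩, ⟨y, false⟩ => ⟨x + y, true⟩
  | ⟨x, false⟩, ⟨y, true⟩ => ⟨x + y, true⟩
  | ⟨x, true⟩, ⟨y, true⟩ => ⟨x + y + 1, false⟩

/-- `x ⊖ y = x - y`, `x* ⊖ y = (x - y)*`, `x* ⊖ y* = x - y`, `x ⊖ y* = (x - y - 1)*`.
Below it is applied only where the subtrahend does not exceed the minuend. -/
def ominus : StarNat → StarNat → StarNat
  | ⟨x, false⟩, ⟨y, false⟩ => ⟨x - y, false⟩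
  | ⟨x, true⟩, ⟨y, false⟩ => ⟨x - y, true⟩
  | ⟨x, true⟩, ⟨y, true⟩ => ⟨x - y, false⟩
  | ⟨x, false⟩, ⟨y, true⟩ => ⟨x - y - 1, true⟩

/-- `b` is a legal bid for a player whose budget is `B`: it is within the budget, and it uses the
advantage only if the player holds it. -/
def LegalBid (B b : StarNat) : Prop := b ≤ B ∧ (b.adv = true → B.adv = true)

theorem ominus_le {B b : StarNat} (h : LegalBid B b) : B.ominus b ≤ B := by
  obtain ⟨x, a⟩ := B
  obtain ⟨y, c⟩ := b
  cases a <;> cases c <;> simp [LegalBid, le_iff_code, code, ominus] at h ⊢ <;> omega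

theorem oplus_le {k : ℕ} {B b : StarNat} (hB : B ≤ ⟨k, true⟩)
    (h : LegalBid (ominus ⟨k, true⟩ B) b) : B.oplus b ≤ ⟨k, true⟩ := by
  obtain ⟨x, a⟩ := B
  obtain ⟨y, c⟩ := b
  cases a <;> cases c <;> simp [LegalBid, le_iff_code, code, ominus, oplus] at h hB ⊢ <;> omega

end StarNat

/-- An energy bidding game `⟨V, E, k, w⟩`: a directed graph in which every vertex has a neighbour,
a total budget `k`, and integer weights on the edges (the values of `weight` on pairs that are not
edges are never used). The players are Preserver (Player 1) and Consumer (Player 2). -/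
structure EnergyGame (V : Type*) where
  /-- `Edge v u` says that `(v, u)` is an edge. -/
  Edge : V → V → Prop
  exists_edge : ∀ v, ∃ u, Edge v u
  /-- The total budget. -/
  k : ℕ
  /-- The weight function. -/
  weight : V → V → ℤ

namespace EnergyGame

variable {V : Type*} (G : EnergyGame V)

/-- The set `[k] = {0, 0*, …, k, k*}`. -/
def Budget : Type := {B : StarNat // B ≤ ⟨G.k, true⟩}

/-- The set `[k] ∪ {k + 1}`, in which `k + 1` is the successor of `k*`. -/
def ExtBudget : Type := {B : StarNat // B ≤ ⟨G.k + 1, false⟩}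

/-- Configurations `⟨v, B⟩`: the token is at `v` and Preserver's budget is `B`. -/
abbrev Config : Type _ := V × G.Budget

/-- Consumer's budget `k* ⊖ B` when Preserver's budget is `B`. -/
def consBudget (B : G.Budget) : StarNat := StarNat.ominus ⟨G.k, true⟩ B.1

/-- Preserver's allowed actions: a legal bid and a neighbour to move to upon winning it. -/
def PresAction (c : G.Config) : Type _ :=
  {a : StarNat × V // StarNat.LegalBid c.2.1 a.1 ∧ G.Edge c.1 a.2}

/-- Consumer's allowed actions: a legal bid and a neighbour to move to upon winning it. -/
def ConsAction (c : G.Config) : Type _ :=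
  {a : StarNat × V // StarNat.LegalBid (G.consBudget c.2) a.1 ∧ G.Edge c.1 a.2}

open Classical in
/-- The transition function. The higher bidder pays his bid to the other player and moves the
token; equal bids are won by the player who does not hold the advantage. -/
noncomputable def step (c : G.Config) (a : G.PresAction c) (b : G.ConsAction c) : G.Config :=
  if b.1.1 < a.1.1 ∨ (a.1.1 = b.1.1 ∧ c.2.1.adv = false) then
    (a.1.2, ⟨c.2.1.ominus a.1.1, (StarNat.ominus_le a.2.1).trans c.2.2⟩)
  else
    (b.1.2, ⟨c.2.1.oplus b.1.1, StarNat.oplus_le c.2.2 b.2.1⟩)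

/-- A strategy of Preserver maps each history, given as the list of the past configurations and
the current one, to an allowed action. -/
def PresStrategy : Type _ := List G.Config → (c : G.Config) → G.PresAction c

/-- A strategy of Consumer. -/
def ConsStrategy : Type _ := List G.Config → (c : G.Config) → G.ConsAction c

/-- The play from `c₀` under two strategies: after `m` turns, the list of the past `m`
configurations in order, and the current one. -/
noncomputable def play (c₀ : G.Config) (σ : G.PresStrategy) (τ : G.ConsStrategy) :
    ℕ → List G.Config × G.Config
  | 0 => ([], c₀)
  | m + 1 =>
    let h := play c₀ σ τ m
    (h.1 ++ [h.2], G.step h.2 (σ h.1 h.2) (τ h.1 h.2))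

/-- The path of vertices that corresponds to a play. -/
noncomputable def path (c₀ : G.Config) (σ : G.PresStrategy) (τ : G.ConsStrategy) (m : ℕ) : V :=
  (G.play c₀ σ τ m).2.1

/-- The sum of the weights of the first `m` edges of a path. -/
def energySum (π : ℕ → V) (m : ℕ) : ℤ :=
  ∑ j ∈ Finset.range m, G.weight (π j) (π (j + 1))

/-- Preserver `M`-wins from `c`. The initial energy is an integer so that `M - 1` makes sense for
`M = 0`; with a negative initial energy Consumer wins at once. -/
def PresWins (M : ℤ) (c : G.Config) : Prop :=
  ∃ σ : G.PresStrategy, ∀ τ : G.ConsStrategy, ∀ m, 0 ≤ M + G.energySum (G.path c σ τ) m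

/-- Consumer `M`-wins from `c`. -/
def ConsWins (M : ℤ) (c : G.Config) : Prop :=
  ∃ τ : G.ConsStrategy, ∀ σ : G.PresStrategy, ∃ m, M + G.energySum (G.path c σ τ) m < 0

/-- `en` is the energy threshold of the game. -/
def IsEnergyThreshold (en : V → G.Budget → ℕ∞) : Prop :=
  ∀ v B,
    (∀ M : ℕ, en v B = M → G.PresWins M (v, B) ∧ G.ConsWins ((M : ℤ) - 1) (v, B)) ∧
    (en v B = ⊤ → ∀ M : ℕ, G.ConsWins M (v, B))

/-- The budgets in `[k]` at which the energy threshold at `v` is finite. -/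
def finiteBudgets (en : V → G.Budget → ℕ∞) (v : V) : Set StarNat :=
  {B | ∃ h : B ≤ ⟨G.k, true⟩, en v ⟨B, h⟩ < ⊤}

open Classical in
/-- The threshold budget: the least budget in `[k]` at which the energy threshold is finite, and
`k + 1` if there is none. -/
noncomputable def threshold (en : V → G.Budget → ℕ∞) (v : V) : G.ExtBudget :=
  if h : (G.finiteBudgets en v).Nonempty then
    ⟨wellFounded_lt.min (G.finiteBudgets en v) h, by
      obtain ⟨hk, -⟩ := wellFounded_lt.min_mem (G.finiteBudgets en v) h
      refine hk.trans ?_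
      simp only [StarNat.le_iff_code, StarNat.code, Bool.toNat_true, Bool.toNat_false]
      omega⟩
  else ⟨⟨G.k + 1, false⟩, le_rfl⟩

/-- The correction `ε ∈ {0, 1, *}`, where `*` is `0* ∈ ℕ*`, as a function of the maximal value
`p` and the minimal value `q` among the neighbours. -/
def epsilon (p q : StarNat) : StarNat :=
  if Even (p.int + q.int) ∧ q.adv = false then ⟨0, false⟩
  else if Odd (p.int + q.int) ∧ q.adv = true then ⟨1, false⟩
  else ⟨0, true⟩

/-- The average property of `T : V → [k] ∪ {k + 1}`:
`T(v) = ⌊(|T(v⁺)| + |T(v⁻)|) / 2⌋ + ε` for every vertex `v`, every neighbour `v⁺` with maximal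
and every neighbour `v⁻` with minimal value of `T`. -/
def AverageProperty (T : V → G.ExtBudget) : Prop :=
  ∀ v vp vm : V,
    G.Edge v vp → (∀ u, G.Edge v u → (T u).1 ≤ (T vp).1) →
    G.Edge v vm → (∀ u, G.Edge v u → (T vm).1 ≤ (T u).1) →
    (T v).1 =
      StarNat.oplus ⟨((T vp).1.int + (T vm).1.int) / 2, false⟩ (epsilon (T vp).1 (T vm).1)

end EnergyGame

/-! Number the elements of `ℕ*` by their position. Then `⊕` and `⊖` are `+` and `-`, a player holds
the advantage iff the position of the budget is odd, and the average of `p` and `q` is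
`⌊p / 2⌋ + ⌈q / 2⌉`. A property of configurations that is preserved when Preserver's budget grows is
given by a threshold `T` at each vertex. In one turn, Preserver's best bid is the largest one that
leaves him at least the minimal value of `T` among the neighbours when he wins it, and Consumer's
best bid is the largest one that keeps Preserver below the maximal value. Comparing the two shows
that a single turn is determined, and that Preserver wins it iff his budget reaches the average.

The pairs of an energy and a configuration from which Consumer can enforce a negative energy are
generated inductively from single turns. Outside of them Preserver can always stay outside, and the
action that does so at the least possible energy works for every larger one, so the whole game is
determined. With finitely many neighbours, some energy suffices at a configuration iff Preserver can
force the next configuration to have this property, and the average property follows from the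
analysis of one turn. -/

namespace StarNat

theorem adv_eq_true_iff (B : StarNat) : B.adv = true ↔ B.code % 2 = 1 := by
  obtain ⟨x, a⟩ := B
  cases a <;> simp [code]

theorem adv_eq_false_iff (B : StarNat) : B.adv = false ↔ B.code % 2 = 0 := by
  obtain ⟨x, a⟩ := B
  cases a <;> simp [code]

theorem int_eq_code_div_two (B : StarNat) : B.int = B.code / 2 := by
  have := B.adv.toNat_lt
  rw [code]
  omega

theorem code_oplus (A B : StarNat) : (A.oplus B).code = A.code + B.code := by
  obtain ⟨x, a⟩ := A
  obtain ⟨y, b⟩ := B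
  cases a <;> cases b <;> simp only [code, oplus, Bool.toNat_true, Bool.toNat_false] <;> omega

theorem code_ominus {A B : StarNat} (h : B ≤ A) : (A.ominus B).code = A.code - B.code := by
  obtain ⟨x, a⟩ := A
  obtain ⟨y, b⟩ := B
  rw [le_iff_code] at h
  cases a <;> cases b <;>
    simp only [code, ominus, Bool.toNat_true, Bool.toNat_false] at h ⊢ <;> omega

theorem legalBid_iff_code (B b : StarNat) :
    LegalBid B b ↔ b.code ≤ B.code ∧ (b.code % 2 = 1 → B.code % 2 = 1) := by
  rw [LegalBid, le_iff_code, adv_eq_true_iff, adv_eq_true_iff]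

theorem legalBid_zero (B : StarNat) : LegalBid B ⟨0, false⟩ :=
  (legalBid_iff_code _ _).2 (by simp [code])

/-- The largest bid at position at most `n` that uses the advantage only if the budget `B` holds
it. -/
def largestBid (B : StarNat) (n : ℕ) : StarNat := ⟨n / 2, B.adv && decide (n % 2 = 1)⟩

theorem code_largestBid (B : StarNat) (n : ℕ) :
    (B.largestBid n).code = if B.code % 2 = 1 then n else 2 * (n / 2) := by
  simp only [← adv_eq_true_iff]
  rcases Nat.mod_two_eq_zero_or_one n with hn | hn <;> cases hB : B.adv <;>
    simp [largestBid, code, hn, hB] <;> omega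

theorem legalBid_largestBid {B : StarNat} {n : ℕ} (h : n ≤ B.code) :
    LegalBid B (B.largestBid n) := by
  rw [legalBid_iff_code, code_largestBid]
  split_ifs <;> omega

theorem finite_setOf_le (X : StarNat) : {B : StarNat | B ≤ X}.Finite :=
  (Set.finite_Iic X.code).preimage code_injective.injOn

end StarNat

namespace EnergyGame

open StarNat

/-- The right-hand side of the average property, as a function of the maximal value `p` and the
minimal value `q` among the neighbours. -/
def average (p q : StarNat) : StarNat :=
  StarNat.oplus ⟨(p.int + q.int) / 2, false⟩ (epsilon p q)

theorem code_average (p q : StarNat) :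
    (average p q).code = p.code / 2 + (q.code + 1) / 2 := by
  rw [average, code_oplus, epsilon]
  simp only [int_eq_code_div_two, adv_eq_true_iff, adv_eq_false_iff, Nat.even_iff, Nat.odd_iff]
  have hnat (n : ℕ) : code ⟨n, false⟩ = 2 * n := rfl
  have hstar : code ⟨0, true⟩ = 1 := rfl
  split_ifs <;> simp only [hnat, hstar] <;> omega

theorem average_le_left {p q : StarNat} (h : q ≤ p) : average p q ≤ p := by
  rw [le_iff_code] at h ⊢
  rw [code_average]
  omega

variable {V : Type*} {G : EnergyGame V}

noncomputable instance : LinearOrder G.Budget :=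
  inferInstanceAs (LinearOrder {B : StarNat // B ≤ ⟨G.k, true⟩})

instance : Finite G.Budget :=
  (finite_setOf_le ⟨G.k, true⟩).to_subtype

theorem code_consBudget (B : G.Budget) : (G.consBudget B).code = 2 * G.k + 1 - B.1.code :=
  code_ominus B.2

instance (c : G.Config) : Nonempty (G.PresAction c) :=
  let ⟨u, hu⟩ := G.exists_edge c.1
  ⟨⟨(⟨0, false⟩, u), legalBid_zero _, hu⟩⟩

instance (c : G.Config) : Nonempty (G.ConsAction c) :=
  let ⟨u, hu⟩ := G.exists_edge c.1
  ⟨⟨(⟨0, false⟩, u), legalBid_zero _, hu⟩⟩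

theorem edge_step (c : G.Config) (a : G.PresAction c) (b : G.ConsAction c) :
    G.Edge c.1 (G.step c a b).1 := by
  rw [step]
  split_ifs
  exacts [a.2.2, b.2.2]

/-! ### One turn -/

variable (G) in
/-- Preserver has an action at `c` that makes the next configuration satisfy `P`, whatever Consumer
does in this turn. -/
def PresForces (P : G.Config → Prop) (c : G.Config) : Prop :=
  ∃ a : G.PresAction c, ∀ b : G.ConsAction c, P (G.step c a b)

variable (G) in
/-- Consumer has an action at `c` that makes the next configuration satisfy `P`, whatever Preserver
does in this turn. -/
def ConsForces (P : G.Config → Prop) (c : G.Config) : Prop :=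
  ∃ b : G.ConsAction c, ∀ a : G.PresAction c, P (G.step c a b)

theorem presForces_of_average_le {T : V → StarNat} {c : G.Config} {vp vm : V}
    (hmax : ∀ u, G.Edge c.1 u → T u ≤ T vp) (hvm : G.Edge c.1 vm)
    (hB : average (T vp) (T vm) ≤ c.2.1) : G.PresForces (fun c' => T c'.1 ≤ c'.2.1) c := by
  have hmp := hmax vm hvm
  rw [le_iff_code] at hmp
  rw [le_iff_code, code_average] at hB
  let bid := c.2.1.largestBid (c.2.1.code - (T vm).code)
  have hbid : bid.code = _ := code_largestBid _ _
  have hlegal : LegalBid c.2.1 bid := legalBid_largestBid (Nat.sub_le _ _)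
  refine ⟨⟨(bid, vm), hlegal, hvm⟩, fun b => ?_⟩
  have hb := b.2.1
  rw [legalBid_iff_code, code_consBudget] at hb
  have hu := hmax _ b.2.2
  simp only [step]
  split_ifs with hwin <;> rw [lt_iff_code, ← code_injective.eq_iff, adv_eq_false_iff] at hwin
  · change T vm ≤ c.2.1.ominus bid
    rw [le_iff_code, code_ominus hlegal.1]
    split_ifs at hbid <;> omega
  · change ¬ (_ < bid.code ∨ bid.code = _ ∧ _) at hwin
    refine hu.trans ?_
    rw [le_iff_code, code_oplus]
    split_ifs at hbid <;> omega

theorem consForces_of_lt_average {T : V → StarNat} {c : G.Config} {vp vm : V}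
    (hT : T vp ≤ ⟨G.k + 1, false⟩) (hvp : G.Edge c.1 vp) (hmin : ∀ u, G.Edge c.1 u → T vm ≤ T u)
    (hB : c.2.1 < average (T vp) (T vm)) : G.ConsForces (fun c' => c'.2.1 < T c'.1) c := by
  have hmp := hmin vp hvp
  rw [le_iff_code] at hmp
  rw [lt_iff_code, code_average] at hB
  have hTk : (T vp).code ≤ 2 * (G.k + 1) := hT
  have hcons := code_consBudget c.2
  let bid := (G.consBudget c.2).largestBid ((T vp).code - c.2.1.code - 1)
  have hbid : bid.code = _ := code_largestBid _ _
  have hlegal : LegalBid (G.consBudget c.2) bid := legalBid_largestBid (by omega)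
  refine ⟨⟨(bid, vp), hlegal, hvp⟩, fun a => ?_⟩
  have ha := a.2.1
  rw [legalBid_iff_code] at ha
  have hu := hmin _ a.2.2
  simp only [step]
  split_ifs with hwin <;> rw [lt_iff_code, ← code_injective.eq_iff, adv_eq_false_iff] at hwin
  · change bid.code < _ ∨ _ = bid.code ∧ _ at hwin
    refine lt_of_lt_of_le ?_ hu
    rw [lt_iff_code, code_ominus a.2.1.1]
    split_ifs at hbid <;> omega
  · change c.2.1.oplus bid < T vp
    rw [lt_iff_code, code_oplus]
    split_ifs at hbid <;> omega

variable (G) in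
/-- `P` holds at exactly those configurations whose budget reaches the value of `T` at their vertex;
at a vertex where `P` holds for no budget, this value is `k + 1`. -/
structure IsThreshold (P : G.Config → Prop) (T : V → StarNat) : Prop where
  le_top : ∀ v, T v ≤ ⟨G.k + 1, false⟩
  le_iff : ∀ c : G.Config, T c.1 ≤ c.2.1 ↔ P c

theorem eq_of_forall_budget_le_iff {X Y : StarNat} (hX : X ≤ ⟨G.k + 1, false⟩)
    (hY : Y ≤ ⟨G.k + 1, false⟩) (h : ∀ B : G.Budget, X ≤ B.1 ↔ Y ≤ B.1) : X = Y := by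
  have hle {X Y : StarNat} (hX : X ≤ ⟨G.k + 1, false⟩) (h : ∀ B : G.Budget, Y ≤ B.1 → X ≤ B.1) :
      X ≤ Y := by
    by_cases hY : Y ≤ ⟨G.k, true⟩
    · exact h ⟨Y, hY⟩ le_rfl
    · refine hX.trans ?_
      simp only [le_iff_code, code, Bool.toNat_true, Bool.toNat_false] at hY ⊢
      omega
  exact le_antisymm (hle hX fun B => (h B).2) (hle hY fun B => (h B).1)

theorem isThreshold_threshold {en : V → G.Budget → ℕ∞}
    (hmono : ∀ v, Monotone fun B => en v B < ⊤) :
    G.IsThreshold (fun c => en c.1 c.2 < ⊤) fun v => (G.threshold en v).1 where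
  le_top v := (G.threshold en v).2
  le_iff := by
    rintro ⟨v, B⟩
    change (G.threshold en v).1 ≤ B.1 ↔ en v B < ⊤
    by_cases h : (G.finiteBudgets en v).Nonempty
    · have hmin : (G.threshold en v).1 = wellFounded_lt.min (G.finiteBudgets en v) h :=
        congrArg Subtype.val (dif_pos h)
      rw [hmin]
      obtain ⟨hk, hfin⟩ := wellFounded_lt.min_mem (G.finiteBudgets en v) h
      exact ⟨fun hB => hmono v (a := ⟨_, hk⟩) hB hfin, fun hB =>
        wellFounded_lt.min_le (s := G.finiteBudgets en v) ⟨B.2, hB⟩⟩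
    · have htop : (G.threshold en v).1 = ⟨G.k + 1, false⟩ := congrArg Subtype.val (dif_neg h)
      rw [htop]
      refine ⟨fun hB => ?_, fun hB => (h ⟨B.1, B.2, hB⟩).elim⟩
      have hk := hB.trans B.2
      simp only [le_iff_code, code, Bool.toNat_true] at hk
      omega

theorem exists_isThreshold {P : G.Config → Prop} (hP : ∀ v, Monotone fun B => P (v, B)) :
    ∃ T, G.IsThreshold P T := by
  classical
  let en (v : V) (B : G.Budget) : ℕ∞ := if P (v, B) then 0 else ⊤
  have hen (v : V) (B : G.Budget) : en v B < ⊤ ↔ P (v, B) := by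
    by_cases h : P (v, B) <;> simp [en, h]
  have h := isThreshold_threshold (G := G) (en := en) (by simpa only [hen] using hP)
  exact ⟨_, by simpa only [hen] using h⟩

section Threshold

variable {P : G.Config → Prop} {T : V → StarNat}

theorem IsThreshold.exists_extreme_neighbours (hT : G.IsThreshold P T) (v : V) :
    ∃ vp vm, (G.Edge v vp ∧ ∀ u, G.Edge v u → T u ≤ T vp) ∧
      G.Edge v vm ∧ ∀ u, G.Edge v u → T vm ≤ T u := by
  have hfin : (T '' {u | G.Edge v u}).Finite :=
    (finite_setOf_le _).subset (Set.image_subset_iff.2 fun u _ => hT.le_top u)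
  obtain ⟨vp, hvp, hmax⟩ := hfin.exists_maximalFor' _ _ (G.exists_edge v)
  obtain ⟨vm, hvm, hmin⟩ := hfin.exists_minimalFor' _ _ (G.exists_edge v)
  exact ⟨vp, vm, ⟨hvp, fun u hu => (le_total _ _).elim id (hmax hu)⟩,
    hvm, fun u hu => (le_total _ _).elim id (hmin hu)⟩

theorem IsThreshold.presForces_of_average_le (hT : G.IsThreshold P T) {c : G.Config} {vp vm : V}
    (hmax : ∀ u, G.Edge c.1 u → T u ≤ T vp) (hvm : G.Edge c.1 vm)
    (hB : average (T vp) (T vm) ≤ c.2.1) : G.PresForces P c := by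
  simpa only [hT.le_iff] using EnergyGame.presForces_of_average_le hmax hvm hB

theorem IsThreshold.consForces_not_of_lt_average (hT : G.IsThreshold P T) {c : G.Config}
    {vp vm : V} (hvp : G.Edge c.1 vp) (hmin : ∀ u, G.Edge c.1 u → T vm ≤ T u)
    (hB : c.2.1 < average (T vp) (T vm)) : G.ConsForces (fun c' => ¬ P c') c := by
  simpa only [← hT.le_iff, not_le] using consForces_of_lt_average (hT.le_top vp) hvp hmin hB

theorem ConsForces.not_presForces {c : G.Config} (h : G.ConsForces (fun c' => ¬ P c') c) :
    ¬ G.PresForces P c :=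
  fun ⟨a, ha⟩ => h.elim fun b hb => hb a (ha b)

theorem IsThreshold.presForces_iff (hT : G.IsThreshold P T) {c : G.Config} {vp vm : V}
    (hvp : G.Edge c.1 vp) (hmax : ∀ u, G.Edge c.1 u → T u ≤ T vp)
    (hvm : G.Edge c.1 vm) (hmin : ∀ u, G.Edge c.1 u → T vm ≤ T u) :
    G.PresForces P c ↔ average (T vp) (T vm) ≤ c.2.1 :=
  ⟨fun h => not_lt.1 fun hB => (hT.consForces_not_of_lt_average hvp hmin hB).not_presForces h,
    hT.presForces_of_average_le hmax hvm⟩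

theorem presForces_or_consForces_not (hP : ∀ v, Monotone fun B => P (v, B)) (c : G.Config) :
    G.PresForces P c ∨ G.ConsForces (fun c' => ¬ P c') c := by
  obtain ⟨T, hT⟩ := exists_isThreshold hP
  obtain ⟨vp, vm, ⟨hvp, hmax⟩, hvm, hmin⟩ := hT.exists_extreme_neighbours c.1
  exact (le_or_gt _ _).imp (hT.presForces_of_average_le hmax hvm)
    (hT.consForces_not_of_lt_average hvp hmin)

theorem monotone_presForces (hP : ∀ v, Monotone fun B => P (v, B)) (v : V) :
    Monotone fun B => G.PresForces P (v, B) := by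
  obtain ⟨T, hT⟩ := exists_isThreshold hP
  obtain ⟨vp, vm, ⟨hvp, hmax⟩, hvm, hmin⟩ := hT.exists_extreme_neighbours v
  intro B B' hB h
  exact hT.presForces_of_average_le hmax hvm
    (((hT.presForces_iff hvp hmax hvm hmin).1 h).trans hB)

theorem IsThreshold.eq_average (hT : G.IsThreshold P T) {v vp vm : V}
    (hv : ∀ B, P (v, B) ↔ G.PresForces P (v, B))
    (hvp : G.Edge v vp) (hmax : ∀ u, G.Edge v u → T u ≤ T vp)
    (hvm : G.Edge v vm) (hmin : ∀ u, G.Edge v u → T vm ≤ T u) :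
    T v = average (T vp) (T vm) := by
  refine eq_of_forall_budget_le_iff (hT.le_top v)
    ((average_le_left (hmin vp hvp)).trans (hT.le_top vp)) fun B => ?_
  rw [hT.le_iff (v, B), hv, hT.presForces_iff hvp hmax hvm hmin]

end Threshold

/-! ### Determinacy -/

variable (G) in
/-- The set of energies and configurations from which Consumer can enforce a negative energy, as the
attractor generated by single turns. -/
inductive Doomed : ℤ → G.Config → Prop
  | of_neg {e : ℤ} {c : G.Config} (he : e < 0) : Doomed e c
  | of_step {e : ℤ} {c : G.Config} (b : G.ConsAction c)
      (hb : ∀ a : G.PresAction c,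
        Doomed (e + G.weight c.1 (G.step c a b).1) (G.step c a b)) : Doomed e c

theorem nonneg_of_not_doomed {e : ℤ} {c : G.Config} (h : ¬ G.Doomed e c) : 0 ≤ e :=
  not_lt.1 fun he => h (.of_neg he)

theorem Doomed.anti_energy {e e' : ℤ} {c : G.Config} (h : G.Doomed e c) (he : e' ≤ e) :
    G.Doomed e' c := by
  induction h generalizing e' with
  | of_neg h0 => exact .of_neg (he.trans_lt h0)
  | of_step b _ ih => exact .of_step b fun a => ih a (by gcongr)

theorem Doomed.anti_budget {e : ℤ} {v : V} {B B' : G.Budget} (h : G.Doomed e (v, B'))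
    (hB : B ≤ B') : G.Doomed e (v, B) := by
  generalize hc : (v, B') = c at h
  induction h generalizing v B B' with
  | of_neg he => exact .of_neg he
  | @of_step e _ b _ ih =>
    subst hc
    -- Closing the successors downwards makes the property monotone before `Doomed` is known to be.
    let P : G.Config → Prop := fun c => ¬ ∀ B ≤ c.2, G.Doomed (e + G.weight v c.1) (c.1, B)
    have hP (u : V) : Monotone fun B => P (u, B) :=
      fun B₁ B₂ h₁₂ h₁ h₂ => h₁ fun B hB => h₂ B (hB.trans h₁₂)
    have hB' : G.ConsForces (fun c => ¬ P c) (v, B') :=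
      ⟨b, fun a => not_not.2 fun _ hB₁ => ih a hB₁ rfl⟩
    obtain ⟨b', hb'⟩ := (presForces_or_consForces_not hP (v, B)).resolve_left
      fun h => hB'.not_presForces (monotone_presForces hP v hB h)
    exact .of_step b' fun a => not_not.1 (hb' a) _ le_rfl

theorem presForces_not_doomed {e : ℤ} {c : G.Config} (h : ¬ G.Doomed e c) :
    G.PresForces (fun c' => ¬ G.Doomed (e + G.weight c.1 c'.1) c') c := by
  have hmono (v : V) : Monotone fun B => ¬ G.Doomed (e + G.weight c.1 v) (v, B) :=
    fun _ _ hB => mt fun h => h.anti_budget hB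
  exact (presForces_or_consForces_not hmono c).resolve_right
    fun ⟨b, hb⟩ => h (.of_step b fun a => not_not.1 (hb a))

theorem exists_presAction_forall_energy (c : G.Config) : ∃ a : G.PresAction c,
    ∀ e, ¬ G.Doomed e c → ∀ b, ¬ G.Doomed (e + G.weight c.1 (G.step c a b).1) (G.step c a b) := by
  by_cases h : ∃ e, ¬ G.Doomed e c
  · obtain ⟨e₀, he₀, hmin⟩ :=
      Int.exists_least_of_bdd ⟨0, fun _ => nonneg_of_not_doomed⟩ h
    obtain ⟨a, ha⟩ := presForces_not_doomed he₀
    refine ⟨a, fun e he b hd => ha b (hd.anti_energy ?_)⟩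
    have := hmin e he
    gcongr
  · exact ⟨Classical.arbitrary _, fun e he => (h ⟨e, he⟩).elim⟩

theorem energySum_succ (π : ℕ → V) (m : ℕ) :
    G.energySum π (m + 1) = G.energySum π m + G.weight (π m) (π (m + 1)) :=
  Finset.sum_range_succ _ _

theorem energySum_succ' (π : ℕ → V) (m : ℕ) :
    G.energySum π (m + 1) = G.weight (π 0) (π 1) + G.energySum (fun j => π (j + 1)) m :=
  (Finset.sum_range_succ' _ _).trans (add_comm _ _)

theorem presWins_of_not_doomed {e : ℤ} {c : G.Config} (h : ¬ G.Doomed e c) : G.PresWins e c := by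
  choose a ha using exists_presAction_forall_energy (G := G)
  let σ : G.PresStrategy := fun _ => a
  refine ⟨σ, fun τ m => ?_⟩
  suffices ¬ G.Doomed (e + G.energySum (G.path c σ τ) m) (G.play c σ τ m).2 from
    nonneg_of_not_doomed this
  induction m with
  | zero => simpa [energySum, play] using h
  | succ m ih =>
    rw [energySum_succ, ← add_assoc]
    exact ha _ _ ih _

theorem play_succ_eq_cons (c : G.Config) (σ : G.PresStrategy) (τ : G.ConsStrategy) (m : ℕ) :
    G.play c σ τ (m + 1) =
      (G.play (G.step c (σ [] c) (τ [] c)) (fun l => σ (c :: l)) (fun l => τ (c :: l)) m).map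
        (List.cons c) id := by
  induction m with
  | zero => rfl
  | succ m ih => rw [play, ih]; rfl

theorem headD_play (c : G.Config) (σ : G.PresStrategy) (τ : G.ConsStrategy) (m : ℕ) :
    (G.play c σ τ m).1.headD (G.play c σ τ m).2 = c := by
  cases m with
  | zero => rfl
  | succ m => rw [play_succ_eq_cons]; rfl

theorem play_headD (c : G.Config) (σ : G.PresStrategy) (τ : G.Config → G.ConsStrategy) (m : ℕ) :
    G.play c σ (fun l x => τ (l.headD x) l x) m = G.play c σ (τ c) m := by
  induction m with
  | zero => rfl
  | succ m ih =>
    let next (h : List G.Config × G.Config) : List G.Config × G.Config :=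
      (h.1 ++ [h.2], G.step h.2 (σ h.1 h.2) (τ (h.1.headD h.2) h.1 h.2))
    calc
      _ = next (G.play c σ (τ c) m) := congrArg next ih
      _ = G.play c σ (τ c) (m + 1) := by simp only [next, headD_play]; rfl

theorem energySum_path_succ (c : G.Config) (σ : G.PresStrategy) (τ : G.ConsStrategy) (m : ℕ) :
    G.energySum (G.path c σ τ) (m + 1) =
      G.weight c.1 (G.step c (σ [] c) (τ [] c)).1 +
        G.energySum (G.path (G.step c (σ [] c) (τ [] c)) (fun l => σ (c :: l))
          fun l => τ (c :: l)) m := by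
  rw [energySum_succ']
  simp only [path, play_succ_eq_cons]
  rfl

theorem consWins_of_neg {e : ℤ} (c : G.Config) (he : e < 0) : G.ConsWins e c :=
  ⟨fun _ _ => Classical.arbitrary _, fun _ => ⟨0, by simpa [energySum] using he⟩⟩

theorem consWins_of_consForces {e : ℤ} {c : G.Config}
    (h : G.ConsForces (fun c' => G.ConsWins (e + G.weight c.1 c'.1) c') c) : G.ConsWins e c := by
  classical
  obtain ⟨b, hb⟩ := h
  have : Nonempty G.ConsStrategy := ⟨fun _ _ => Classical.arbitrary _⟩
  choose! τ hτ using fun c' (h : G.ConsWins (e + G.weight c.1 c'.1) c') => h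
  -- The configuration `l.headD x` reached after the first turn selects the strategy that is
  -- followed from then on.
  let τ₀ : G.ConsStrategy
    | [], x => Function.update (fun _ => Classical.arbitrary _) c b x
    | _ :: l, x => τ (l.headD x) l x
  refine ⟨τ₀, fun σ => ?_⟩
  obtain ⟨m, hm⟩ := hτ _ (hb (σ [] c)) fun l => σ (c :: l)
  refine ⟨m + 1, ?_⟩
  have hfirst : τ₀ [] c = b := Function.update_self ..
  rw [energySum_path_succ, hfirst, ← add_assoc]
  have hpath (c' : G.Config) : G.path c' (fun l => σ (c :: l)) (fun l => τ₀ (c :: l)) =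
      G.path c' (fun l => σ (c :: l)) (τ c') :=
    funext fun j => congrArg (fun h => h.2.1) (play_headD _ _ τ j)
  rw [hpath]
  exact hm

theorem Doomed.consWins {e : ℤ} {c : G.Config} (h : G.Doomed e c) : G.ConsWins e c := by
  induction h with
  | of_neg he => exact consWins_of_neg _ he
  | of_step b _ ih => exact consWins_of_consForces ⟨b, ih⟩

theorem PresWins.lt_of_consWins {c : G.Config} {M M' : ℤ} (h : G.PresWins M c)
    (h' : G.ConsWins M' c) : M' < M := by
  obtain ⟨σ, hσ⟩ := h
  obtain ⟨τ, hτ⟩ := h'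
  obtain ⟨m, hm⟩ := hτ σ
  linarith [hσ τ m]

theorem presWins_iff_not_doomed {e : ℤ} {c : G.Config} : G.PresWins e c ↔ ¬ G.Doomed e c :=
  ⟨fun h hd => (h.lt_of_consWins hd.consWins).false, presWins_of_not_doomed⟩

theorem consWins_of_not_presWins {e : ℤ} {c : G.Config} (h : ¬ G.PresWins e c) :
    G.ConsWins e c :=
  (not_not.1 (presWins_iff_not_doomed.not.1 h)).consWins

theorem PresWins.nonneg {e : ℤ} {c : G.Config} (h : G.PresWins e c) : 0 ≤ e :=
  nonneg_of_not_doomed (presWins_iff_not_doomed.1 h)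

theorem PresWins.mono_energy {e e' : ℤ} {c : G.Config} (h : G.PresWins e c) (he : e ≤ e') :
    G.PresWins e' c := by
  rw [presWins_iff_not_doomed] at h ⊢
  exact fun hd => h (hd.anti_energy he)

theorem PresWins.mono_budget {e : ℤ} {v : V} {B B' : G.Budget} (h : G.PresWins e (v, B))
    (hB : B ≤ B') : G.PresWins e (v, B') := by
  rw [presWins_iff_not_doomed] at h ⊢
  exact fun hd => h (hd.anti_budget hB)

theorem presWins_iff_presForces {e : ℤ} (he : 0 ≤ e) {c : G.Config} :
    G.PresWins e c ↔ G.PresForces (fun c' => G.PresWins (e + G.weight c.1 c'.1) c') c := by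
  simp only [presWins_iff_not_doomed]
  refine ⟨presForces_not_doomed, fun ⟨a, ha⟩ hd => ?_⟩
  cases hd with
  | of_neg h => exact he.not_gt h
  | of_step b hb => exact ha b (hb a)

/-! ### The energy threshold -/

theorem isEnergyThreshold_iff {en : V → G.Budget → ℕ∞} :
    G.IsEnergyThreshold en ↔ ∀ v B (M : ℕ), en v B ≤ M ↔ G.PresWins M (v, B) := by
  refine ⟨fun h v B M => ?_, fun h v B => ⟨fun M hM => ⟨(h v B M).1 hM.le, ?_⟩, fun htop M => ?_⟩⟩
  · cases hen : en v B with
    | top =>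
      have hcons := (h v B).2 hen M
      simpa using fun hpres : G.PresWins M (v, B) => (hpres.lt_of_consWins hcons).false
    | coe N =>
      obtain ⟨hpres, hcons⟩ := (h v B).1 N hen
      rw [Nat.cast_le]
      refine ⟨fun hNM => hpres.mono_energy (by exact_mod_cast hNM), fun hM => ?_⟩
      have := hM.lt_of_consWins hcons
      omega
  · refine consWins_of_not_presWins fun hpres => ?_
    obtain ⟨N, hN⟩ := Int.eq_ofNat_of_zero_le hpres.nonneg
    rw [hN, ← h, hM, Nat.cast_le] at hpres
    omega
  · exact consWins_of_not_presWins fun hpres => by simpa [htop] using (h v B M).2 hpres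

theorem existsUnique_isEnergyThreshold (G : EnergyGame V) :
    ∃! en : V → G.Budget → ℕ∞, G.IsEnergyThreshold en := by
  refine existsUnique_of_exists_of_unique
    ⟨fun v B => ⨅ (M : ℕ) (_ : G.PresWins M (v, B)), (M : ℕ∞),
      isEnergyThreshold_iff.2 fun v B M => ⟨fun h => ?_, fun h => iInf₂_le M h⟩⟩
    fun en en' hen hen' => ?_
  · have hlt : ⨅ (N : ℕ) (_ : G.PresWins N (v, B)), (N : ℕ∞) < (M + 1 : ℕ) :=
      h.trans_lt (by exact_mod_cast M.lt_succ_self)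
    simp only [iInf_lt_iff, Nat.cast_lt] at hlt
    obtain ⟨N, hN, hNM⟩ := hlt
    exact hN.mono_energy (by omega)
  · rw [isEnergyThreshold_iff] at hen hen'
    refine funext₂ fun v B => eq_of_forall_ge_iff fun X => ?_
    cases X with
    | top => simp
    | coe M => rw [hen, hen']

theorem IsEnergyThreshold.lt_top_iff {en : V → G.Budget → ℕ∞} (h : G.IsEnergyThreshold en)
    (c : G.Config) : en c.1 c.2 < ⊤ ↔ ∃ M, G.PresWins M c := by
  rw [isEnergyThreshold_iff] at h
  refine ⟨fun hlt => ?_, fun ⟨M, hM⟩ => ?_⟩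
  · obtain ⟨N, hN⟩ := ENat.ne_top_iff_exists.1 hlt.ne
    exact ⟨N, (h c.1 c.2 N).1 hN.ge⟩
  · obtain ⟨N, rfl⟩ := Int.eq_ofNat_of_zero_le hM.nonneg
    exact ((h c.1 c.2 N).2 hM).trans_lt (ENat.natCast_lt_top N)

theorem exists_presWins_iff_presForces {c : G.Config} (hfin : {u | G.Edge c.1 u}.Finite) :
    (∃ M, G.PresWins M c) ↔ G.PresForces (fun c' => ∃ M, G.PresWins M c') c := by
  refine ⟨fun ⟨M, hM⟩ => ?_, fun ⟨a, ha⟩ => ?_⟩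
  · obtain ⟨a, ha⟩ := (presWins_iff_presForces hM.nonneg).1 hM
    exact ⟨a, fun b => ⟨_, ha b⟩⟩
  · have hsucc : (Set.range (G.step c a)).Finite :=
      (hfin.prod Set.finite_univ).subset
        (Set.range_subset_iff.2 fun b => ⟨edge_step c a b, trivial⟩)
    have hlarge : ∀ᶠ M in Filter.atTop, ∀ c' ∈ Set.range (G.step c a),
        G.PresWins (M + G.weight c.1 c'.1) c' := by
      rw [Filter.eventually_all_finite hsucc, Set.forall_mem_range]
      intro b
      obtain ⟨N, hN⟩ := ha b
      filter_upwards [Filter.eventually_ge_atTop (N - G.weight c.1 (G.step c a b).1)] with M hM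
      exact hN.mono_energy (by linarith)
    obtain ⟨M, hM, hM0⟩ := (hlarge.and (Filter.eventually_ge_atTop 0)).exists
    exact ⟨M, (presWins_iff_presForces hM0).2 ⟨a, fun b => hM _ ⟨b, rfl⟩⟩⟩

theorem IsEnergyThreshold.averageProperty {en : V → G.Budget → ℕ∞} (h : G.IsEnergyThreshold en)
    (hfin : ∀ v, {u | G.Edge v u}.Finite) : G.AverageProperty (G.threshold en) := by
  have hmono (v : V) : Monotone fun B => ∃ M, G.PresWins M (v, B) :=
    fun _ _ hB ⟨M, hM⟩ => ⟨M, hM.mono_budget hB⟩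
  have hT := isThreshold_threshold (G := G) (en := en) fun v => by
    simpa only [h.lt_top_iff (v, _)] using hmono v
  simp only [h.lt_top_iff] at hT
  exact fun v _ _ => hT.eq_average fun B => exists_presWins_iff_presForces (c := (v, B)) (hfin v)

end EnergyGame

theorem mainTheorem2_general {V : Type*} (G : EnergyGame V) :
    (∃! en : V → G.Budget → ℕ∞, G.IsEnergyThreshold en) ∧
    ((∀ v, {u | G.Edge v u}.Finite) → ∀ en : V → G.Budget → ℕ∞, G.IsEnergyThreshold en →
      G.AverageProperty (G.threshold en)) :=
  ⟨G.existsUnique_isEnergyThreshold, fun hfin _ h => h.averageProperty hfin⟩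

theorem mainTheorem2 {V : Type*} [Finite V] (G : EnergyGame V) :
    (∃! en : V → G.Budget → ℕ∞, G.IsEnergyThreshold en) ∧
    ∀ en : V → G.Budget → ℕ∞, G.IsEnergyThreshold en →
      G.AverageProperty (G.threshold en) :=
  (mainTheorem2_general G).imp_right fun h => h fun _ => Set.toFinite _
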